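/- For a regular language $L$ over a finite alphabet, let $\mathrm{dsc}(L)$ be the number of states of the minimal complete deterministic finite automaton accepting $L$ (a sink state, if needed, is counted), and let $L^R=\{w^R : w\in L\}$ be its reversal. **Theorem.** 1. (Upper bound.) For every $k$ there is a constant $C>0$ such that, for every alphabet $\Sigma$ with $|\Sigma|=k$, every $\ell>0$ and every $L\subseteq\Sigma^\ell$ with $\mathrm{dsc}(L)=m$, $$\mathrm{dsc}(L^R)\le 2^{C\sqrt m}.$$ 2. (The bound is tight, already over a two-letter alphabet.) There is a constant $c>0$ such that for every $m\ge 3$ there are $\ell>0$ and $L\subseteq\{a,b\}^\ell$ with $\mathrm{dsc}(L)=m$ and $$\mathrm{dsc}(L^R)\ge 2^{c\sqrt m}.$$ 3. (Witnesses.) For $\ell>0$ let $r=\min\{i\in\{0,\dots,\ell\} : 2^{\ell-i}\le 2^{2^i}-1\}$ and $t_\ell=\max(2^{\ell-r},\,2^{2^{r-1}}-1)$, and let $r_\ell=r$ if $t_\ell=2^{\ell-r}$ and $r_\ell=r-1$ otherwise. For a word $w$ over $\{a,b\}$ let $\mathrm{ind}(w)$ be its index, counted from $0$, in the lexicographically ordered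 list of all words of length $|w|$ (with $a<b$). Let $\mathrm{MAX}_\ell\subseteq\{a,b\}^\ell$ be the set of all words $w_1w_2$ with $|w_1|=\ell-r_\ell$ and $|w_2|=r_\ell$ such that the bit of weight $2^{\mathrm{ind}(w_2)}$ in the binary representation of $\mathrm{ind}(w_1)+1$ is $1$. Then there are constants $C,c>0$ such that, for every $\ell>0$, $$\mathrm{dsc}(\mathrm{MAX}_\ell^R)\le C\ell^2,\qquad \mathrm{dsc}(\mathrm{MAX}_\ell)\ge 2^{c\ell},\qquad \mathrm{dsc}(\mathrm{MAX}_\ell)\ge 2^{c\sqrt{m_\ell}}\ \text{ where } m_\ell=\mathrm{dsc}(\mathrm{MAX}_\ell^R).$$ -/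

import Mathlib

namespace BlockLanguage

/-- The deterministic state complexity of `L`: the least number of states of a complete
deterministic finite automaton accepting `L` (a sink state, if needed, is counted).
Every language that has a finite automaton has one with state set `Fin n`. -/
noncomputable def dsc {α : Type*} (L : Language α) : ℕ :=
  sInf {n : ℕ | ∃ M : DFA α (Fin n), M.accepts = L}

/-- `L` is a block language of block length `ℓ`: all its words have length `ℓ`. -/
def IsBlock {α : Type*} (ℓ : ℕ) (L : Language α) : Prop :=
  ∀ w ∈ L, w.length = ℓ

/-- The index of a word over `{a, b}`, encoded as `{0, 1}`, in the lexicographically ordered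
list of all words of the same length, starting from index `0`; see `lexIndex_eq_ncard`. -/
def lexIndex : List (Fin 2) → ℕ
  | [] => 0
  | σ :: w => σ.val * 2 ^ w.length + lexIndex w

theorem ncard_length_eq (n : ℕ) : {u : List (Fin 2) | u.length = n}.ncard = 2 ^ n := by
  have h := card_vector (α := Fin 2) n
  rw [Fintype.card_fin] at h
  rw [← h, ← Nat.card_eq_fintype_card]
  rfl

/-- `lexIndex w` is the number of words of the same length that precede `w`. -/
theorem lexIndex_eq_ncard (w : List (Fin 2)) :
    lexIndex w = {u : List (Fin 2) | u.length = w.length ∧ u < w}.ncard := by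
  induction w with
  | nil => simp [lexIndex]
  | cons σ w ih =>
    have inj : ∀ τ : Fin 2, Function.Injective (fun u : List (Fin 2) => τ :: u) :=
      fun τ u v h => List.tail_eq_of_cons_eq h
    have hfin : ∀ n, {u : List (Fin 2) | u.length = n}.Finite := fun n => List.finite_length_eq _ n
    have hfin' : {u : List (Fin 2) | u.length = w.length ∧ u < w}.Finite :=
      (hfin w.length).subset fun u h => h.1
    obtain rfl | rfl : σ = 0 ∨ σ = 1 := by omega
    · have : {u : List (Fin 2) | u.length = (0 :: w).length ∧ u < 0 :: w} =
          (fun u => 0 :: u) '' {u | u.length = w.length ∧ u < w} := by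
        ext u
        cases u with
        | nil => simp
        | cons τ u => simp [List.cons_lt_cons_iff]; grind
      rw [this, Set.ncard_image_of_injective _ (inj 0), ← ih]
      simp [lexIndex]
    · have : {u : List (Fin 2) | u.length = (1 :: w).length ∧ u < 1 :: w} =
          (fun u => 0 :: u) '' {u | u.length = w.length} ∪
          (fun u => 1 :: u) '' {u | u.length = w.length ∧ u < w} := by
        ext u
        cases u with
        | nil => simp
        | cons τ u =>
          obtain rfl | rfl : τ = 0 ∨ τ = 1 := by omega
          all_goals simp [List.cons_lt_cons_iff]
      rw [this, Set.ncard_union_eq _ ((hfin _).image _) (hfin'.image _),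
        Set.ncard_image_of_injective _ (inj 0), Set.ncard_image_of_injective _ (inj 1), ← ih,
        ncard_length_eq]
      · simp [lexIndex]
      · rw [Set.disjoint_left]
        rintro _ ⟨u, _, rfl⟩ ⟨v, _, h⟩
        simp at h

/-- The least `i ∈ {0, …, ℓ}` with `2 ^ (ℓ - i) ≤ 2 ^ (2 ^ i) - 1`.
The set is non-empty (it contains `ℓ`), and `1 ≤ rankMin ℓ` when `0 < ℓ`. -/
noncomputable def rankMin (ℓ : ℕ) : ℕ :=
  sInf {i : ℕ | i ≤ ℓ ∧ 2 ^ (ℓ - i) ≤ 2 ^ (2 ^ i) - 1}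

/-- With `r = rankMin ℓ` and `t = max (2 ^ (ℓ - r)) (2 ^ (2 ^ (r - 1)) - 1)`, this is `r` if
`t = 2 ^ (ℓ - r)` and `r - 1` otherwise. -/
noncomputable def splitRank (ℓ : ℕ) : ℕ :=
  if max (2 ^ (ℓ - rankMin ℓ)) (2 ^ (2 ^ (rankMin ℓ - 1)) - 1) = 2 ^ (ℓ - rankMin ℓ)
  then rankMin ℓ else rankMin ℓ - 1

/-- The language `MAX_ℓ` of all words `w₁ w₂` with `|w₁| = ℓ - r_ℓ` and `|w₂| = r_ℓ` such that
the bit of weight `2 ^ j` in the binary representation of `i + 1` is `1`, where `i` and `j` are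
the lexicographic indices of `w₁` and `w₂`. -/
def maxLang (ℓ : ℕ) : Language (Fin 2) :=
  {w | ∃ w₁ w₂ : List (Fin 2), w = w₁ ++ w₂ ∧ w₁.length = ℓ - splitRank ℓ ∧
    w₂.length = splitRank ℓ ∧ (lexIndex w₁ + 1).testBit (lexIndex w₂) = true}

end BlockLanguage

/-! State complexity is the number of left quotients. In a block language these fall into levels by
prefix length, and nonempty quotients at different levels differ. Upper bound: level `j` of the
reversal embeds into the subsets of the nonempty quotients of `L` at level `ℓ - j`, and a level
grows by at most the alphabet size per letter. With `s ^ 2 > dsc L`, any `s` consecutive levels of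
`L` include one with fewer than `s` nonempty quotients, so each reversed level is at most
exponential in `s` (`ncard_quotientLevel_reverse_le_pow`); there are at most `dsc L` levels.
Witnesses: in `bitLang`, different numbers have different bits, so prefixes are distinguishable
(`lt_dsc_bitLang`). The reversal reads the bit index first, then the number from its low end, and
needs only a position, that index, one bit and a carry (`dsc_reverse_bitLang_le`). Prefixing a fixed
letter then adjusts the state count to any `m`. -/

namespace BlockLanguage

/-! ### Counting left quotients -/

section Quotients

variable {α : Type*} {L : Language α} {ℓ : ℕ}

/-- The state complexity is the number of left quotients. -/
theorem dsc_eq_ncard (L : Language α) : dsc L = (Set.range L.leftQuotient).ncard := by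
  have key : ∀ n, (∃ M : DFA α (Fin n), M.accepts = L) →
      (Set.range L.leftQuotient).Finite ∧ (Set.range L.leftQuotient).ncard ≤ n := by
    rintro n ⟨M, rfl⟩
    have hsub : Set.range M.accepts.leftQuotient ⊆ M.acceptsFrom '' Set.univ := by
      rintro _ ⟨x, rfl⟩
      exact ⟨M.eval x, trivial, (Language.leftQuotient_accepts_apply M x).symm⟩
    have hfin : (M.acceptsFrom '' Set.univ).Finite := Set.finite_univ.image _
    refine ⟨hfin.subset hsub, (Set.ncard_le_ncard hsub hfin).trans ?_⟩
    simpa [Set.ncard_univ] using Set.ncard_image_le (f := M.acceptsFrom) Set.finite_univ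
  by_cases hfin : (Set.range L.leftQuotient).Finite
  · have := hfin.fintype
    have hmem : (Set.range L.leftQuotient).ncard ∈
        {n : ℕ | ∃ M : DFA α (Fin n), M.accepts = L} := by
      rw [← Nat.card_coe_set_eq]
      exact ⟨DFA.reindex (Finite.equivFin _) L.toDFA,
        (DFA.accepts_reindex _ _).trans (Language.accepts_toDFA L)⟩
    exact le_antisymm (Nat.sInf_le hmem) (key _ (Nat.sInf_mem ⟨_, hmem⟩)).2
  -- For a non-regular language both sides take the default value `0`.
  · rw [Set.Infinite.ncard hfin, dsc]
    have : {n : ℕ | ∃ M : DFA α (Fin n), M.accepts = L} = ∅ :=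
      Set.eq_empty_of_forall_notMem fun n hn => hfin (key n hn).1
    rw [this, Nat.sInf_empty]

theorem IsBlock.reverse (h : IsBlock ℓ L) : IsBlock ℓ L.reverse := fun w hw => by
  simpa using h _ hw

theorem IsBlock.leftQuotient_eq_zero (h : IsBlock ℓ L) {x : List α} (hx : ℓ < x.length) :
    L.leftQuotient x = 0 := by
  refine Set.eq_empty_of_forall_notMem fun y hy => ?_
  have := h _ hy
  simp at this
  omega

theorem IsBlock.length_of_mem_leftQuotient (h : IsBlock ℓ L) {x y : List α}
    (hy : y ∈ L.leftQuotient x) : x.length + y.length = ℓ := by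
  simpa using h _ hy

theorem IsBlock.range_leftQuotient_subset (h : IsBlock ℓ L) :
    Set.range L.leftQuotient ⊆ insert 0 (L.leftQuotient '' {x | x.length ≤ ℓ}) := by
  rintro _ ⟨x, rfl⟩
  by_cases hx : x.length ≤ ℓ
  · exact Or.inr ⟨x, hx, rfl⟩
  · exact Or.inl (h.leftQuotient_eq_zero (not_le.mp hx))

theorem IsBlock.finite_range_leftQuotient [Finite α] (h : IsBlock ℓ L) :
    (Set.range L.leftQuotient).Finite :=
  (((List.finite_length_le α ℓ).image _).insert 0).subset h.range_leftQuotient_subset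

theorem IsBlock.dsc_pos [Finite α] (h : IsBlock ℓ L) : 0 < dsc L := by
  rw [dsc_eq_ncard, Set.ncard_pos h.finite_range_leftQuotient]
  exact Set.range_nonempty _

theorem ncard_image_le_of_factors {X β Q : Type*} {A : Set X} (g : X → Q) (f : X → β)
    (S : Finset β) (hS : ∀ x ∈ A, f x ∈ S)
    (hf : ∀ x ∈ A, ∀ y ∈ A, f x = f y → g x = g y) : (g '' A).ncard ≤ S.card := by
  classical
  rcases A.eq_empty_or_nonempty with rfl | ⟨a, ha⟩
  · simp
  let h : β → Q := fun b => if hb : ∃ x ∈ A, f x = b then g hb.choose else g a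
  have hsub : g '' A ⊆ h '' S := by
    rintro _ ⟨x, hx, rfl⟩
    have hb : ∃ y ∈ A, f y = f x := ⟨x, hx, rfl⟩
    refine ⟨f x, hS x hx, ?_⟩
    simp only [h, dif_pos hb]
    exact hf _ hb.choose_spec.1 _ hx hb.choose_spec.2
  calc (g '' A).ncard ≤ (h '' S).ncard := Set.ncard_le_ncard hsub (S.finite_toSet.image _)
    _ ≤ (S : Set β).ncard := Set.ncard_image_le S.finite_toSet
    _ = S.card := Set.ncard_coe_finset S

/-- `f` plays the role of an automaton state; the `+ 1` pays for the sink reached by words longer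
than `ℓ`. -/
theorem IsBlock.dsc_le_of_factors [Finite α] (h : IsBlock ℓ L) {β : Type*} (f : List α → β)
    (S : Finset β) (hS : ∀ x : List α, x.length ≤ ℓ → f x ∈ S)
    (hf : ∀ x y : List α, x.length ≤ ℓ → y.length ≤ ℓ → f x = f y →
      L.leftQuotient x = L.leftQuotient y) : dsc L ≤ S.card + 1 := by
  have hfin : (L.leftQuotient '' {x | x.length ≤ ℓ}).Finite :=
    (List.finite_length_le α ℓ).image _
  rw [dsc_eq_ncard]
  refine (Set.ncard_le_ncard h.range_leftQuotient_subset (hfin.insert 0)).trans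
    ((Set.ncard_insert_le _ _).trans (Nat.add_le_add_right ?_ 1))
  exact ncard_image_le_of_factors _ f S hS fun x hx y hy => hf x y hx hy

theorem IsBlock.zero_mem_range_leftQuotient [Nonempty α] (h : IsBlock ℓ L) :
    (0 : Language α) ∈ Set.range L.leftQuotient :=
  ⟨List.replicate (ℓ + 1) (Classical.arbitrary α), h.leftQuotient_eq_zero (by simp)⟩

/-- The inequality is strict because the empty quotient is always one more state. -/
theorem IsBlock.lt_dsc_of_injOn [Finite α] [Nonempty α] (h : IsBlock ℓ L) {N : ℕ}
    (g : ℕ → List α) (hinj : ∀ i < N, ∀ j < N, L.leftQuotient (g i) = L.leftQuotient (g j) → i = j)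
    (hne : ∀ i < N, L.leftQuotient (g i) ≠ 0) : N < dsc L := by
  classical
  have hcard : ((fun i => L.leftQuotient (g i)) '' (Finset.range N)).ncard = N := by
    rw [Set.InjOn.ncard_image, Set.ncard_coe_finset, Finset.card_range]
    intro i hi j hj hij
    exact hinj i (by simpa using hi) j (by simpa using hj) hij
  have hfin : ((fun i => L.leftQuotient (g i)) '' (Finset.range N)).Finite :=
    (Finset.finite_toSet _).image _
  have hnot : (0 : Language α) ∉ (fun i => L.leftQuotient (g i)) '' (Finset.range N) := by
    rintro ⟨i, hi, h0⟩
    exact hne i (by simpa using hi) h0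
  rw [dsc_eq_ncard, ← Nat.succ_le_iff]
  calc N.succ = (insert 0 ((fun i => L.leftQuotient (g i)) '' (Finset.range N))).ncard := by
        rw [Set.ncard_insert_of_notMem hnot hfin, hcard]
    _ ≤ _ := Set.ncard_le_ncard (Set.insert_subset h.zero_mem_range_leftQuotient (by
        rintro _ ⟨i, -, rfl⟩; exact ⟨g i, rfl⟩)) h.finite_range_leftQuotient

end Quotients

/-! ### The upper bound, level by level -/

section UpperBound

variable {α : Type*} {L : Language α} {ℓ : ℕ}

/-- The left quotients of `L` by words of length `i`. -/
def quotientLevel (L : Language α) (i : ℕ) : Set (Language α) :=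
  L.leftQuotient '' {x | x.length = i}

theorem quotientLevel_finite [Finite α] (L : Language α) (i : ℕ) : (quotientLevel L i).Finite :=
  (List.finite_length_eq α i).image _

theorem ncard_quotientLevel_add_le [Fintype α] (L : Language α) (i t : ℕ) :
    (quotientLevel L (i + t)).ncard ≤ Fintype.card α ^ t * (quotientLevel L i).ncard := by
  induction t with
  | zero => simp
  | succ t ih =>
    have hsub : quotientLevel L (i + (t + 1)) ⊆
        (fun p : Language α × α => p.1.leftQuotient [p.2]) ''
          (quotientLevel L (i + t) ×ˢ Set.univ) := by
      rintro _ ⟨x, hx, rfl⟩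
      rcases List.eq_nil_or_concat x with rfl | ⟨y, a, rfl⟩
      · simp at hx
      · refine ⟨(L.leftQuotient y, a), ⟨⟨y, ?_, rfl⟩, trivial⟩, ?_⟩
        · simp at hx ⊢; omega
        · simp [Language.leftQuotient_append]
    have hfin := (quotientLevel_finite L (i + t)).prod (Set.finite_univ (α := α))
    calc _ ≤ _ := Set.ncard_le_ncard hsub (hfin.image _)
      _ ≤ _ := Set.ncard_image_le hfin
      _ = (quotientLevel L (i + t)).ncard * Fintype.card α := by
        rw [Set.ncard_prod, Set.ncard_univ, Nat.card_eq_fintype_card]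
      _ ≤ _ := by rw [pow_succ, mul_right_comm]; exact Nat.mul_le_mul_right _ ih

/-- A word `v` lies in the quotient of `L.reverse` by `u` iff `u.reverse` lies in the quotient of
`L` by `v.reverse`. So the set of level-`i` quotients containing `u.reverse` determines the quotient
by `u`. -/
theorem IsBlock.ncard_quotientLevel_reverse_le [Finite α] (h : IsBlock ℓ L) {i j : ℕ}
    (hij : i + j = ℓ) :
    (quotientLevel L.reverse j).ncard ≤ 2 ^ (quotientLevel L i \ {0}).ncard := by
  have hfin : (quotientLevel L i \ {0}).Finite := (quotientLevel_finite L i).sdiff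
  have hsub : quotientLevel L.reverse j ⊆
      (fun T : Set (Language α) =>
        ({v | v.length = i ∧ L.leftQuotient v.reverse ∈ T} : Language α)) ''
        (𝒫 (quotientLevel L i \ {0})) := by
    rintro _ ⟨u, hu, rfl⟩
    refine ⟨{Q | Q ∈ quotientLevel L i \ {0} ∧ u.reverse ∈ Q}, fun Q hQ => hQ.1, ?_⟩
    ext v
    change (v.length = i ∧ (_ ∧ L.leftQuotient v.reverse ∉ ({0} : Set (Language α))) ∧
      v.reverse ++ u.reverse ∈ L) ↔ (u ++ v).reverse ∈ L
    rw [List.reverse_append]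
    refine ⟨fun hv => hv.2.2, fun hv => ?_⟩
    have hlen := h _ hv
    simp at hlen hu
    have hi : v.length = i := by omega
    refine ⟨hi, ⟨⟨v.reverse, by simpa using hi, rfl⟩, fun h0 => ?_⟩, hv⟩
    have : u.reverse ∈ L.leftQuotient v.reverse := hv
    rw [Set.mem_singleton_iff.mp h0] at this
    exact this
  calc _ ≤ _ := Set.ncard_le_ncard hsub (hfin.powerset.image _)
    _ ≤ _ := Set.ncard_image_le hfin.powerset
    _ = _ := Set.ncard_powerset _ hfin

/-- Any word of a quotient reveals its level, since prefix and suffix lengths add up to `ℓ`. -/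
theorem IsBlock.sum_ncard_quotientLevel_le [Finite α] (h : IsBlock ℓ L) (s : Finset ℕ) :
    ∑ i ∈ s, (quotientLevel L i \ {0}).ncard ≤ dsc L := by
  classical
  have hfin : ∀ i, (quotientLevel L i \ {0}).Finite := fun i => (quotientLevel_finite L i).sdiff
  rw [dsc_eq_ncard]
  calc ∑ i ∈ s, (quotientLevel L i \ {0}).ncard
      = ∑ i ∈ s, (hfin i).toFinset.card :=
        Finset.sum_congr rfl fun i _ => Set.ncard_eq_toFinset_card _ (hfin i)
    _ = (s.biUnion fun i => (hfin i).toFinset).card := by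
        refine (Finset.card_biUnion fun i _ j _ hij => ?_).symm
        rw [Function.onFun, Finset.disjoint_left]
        intro Q hQi hQj
        rw [Set.Finite.mem_toFinset] at hQi hQj
        obtain ⟨⟨x, hx, rfl⟩, hne⟩ := hQi
        obtain ⟨⟨y, hy, hxy⟩, -⟩ := hQj
        obtain ⟨z, hz⟩ := Set.nonempty_iff_ne_empty.mpr hne
        have h1 := h.length_of_mem_leftQuotient hz
        have h2 := h.length_of_mem_leftQuotient (hxy ▸ hz : z ∈ L.leftQuotient y)
        rw [Set.mem_ofPred_eq] at hx hy
        omega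
    _ = ((s.biUnion fun i => (hfin i).toFinset : Finset (Language α)) :
        Set (Language α)).ncard :=
        (Set.ncard_coe_finset _).symm
    _ ≤ (Set.range L.leftQuotient).ncard := by
        refine Set.ncard_le_ncard ?_ h.finite_range_leftQuotient
        intro Q hQ
        rw [Finset.mem_coe, Finset.mem_biUnion] at hQ
        obtain ⟨i, -, hQ⟩ := hQ
        obtain ⟨⟨x, -, rfl⟩, -⟩ := (hfin i).mem_toFinset.mp hQ
        exact ⟨x, rfl⟩

theorem IsBlock.succ_le_dsc [Finite α] (h : IsBlock ℓ L) {w : List α} (hw : w ∈ L) :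
    ℓ + 1 ≤ dsc L := by
  refine le_trans ?_ (h.sum_ncard_quotientLevel_le (Finset.range (ℓ + 1)))
  calc ℓ + 1 = ∑ _i ∈ Finset.range (ℓ + 1), 1 := by simp
    _ ≤ _ := Finset.sum_le_sum fun i hi => ?_
  rw [Finset.mem_range] at hi
  rw [Nat.one_le_iff_ne_zero, ← Nat.pos_iff_ne_zero,
    Set.ncard_pos (quotientLevel_finite L i).sdiff]
  have hlen := h w hw
  refine ⟨L.leftQuotient (w.take i), ⟨w.take i, ?_, rfl⟩, fun h0 => ?_⟩
  · simp; omega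
  · have : w.drop i ∈ L.leftQuotient (w.take i) := by simpa using hw
    rw [Set.mem_singleton_iff.mp h0] at this
    exact this

/-- Pigeonhole: among `s` consecutive levels with `dsc L < s * s` one has fewer than `s`
non-empty quotients, so no level of the reversal has more than `(2 * K) ^ s` quotients. -/
theorem IsBlock.ncard_quotientLevel_reverse_le_pow [Fintype α] (h : IsBlock ℓ L) {s j K : ℕ}
    (hs : dsc L < s * s) (hK : Fintype.card α ≤ K) (hK' : 0 < K) (hj : j ≤ ℓ) :
    (quotientLevel L.reverse j).ncard ≤ (2 * K) ^ s := by
  rw [mul_pow]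
  have hstep : ∀ i t, t ≤ s → (quotientLevel L.reverse (i + t)).ncard ≤
      K ^ s * (quotientLevel L.reverse i).ncard := fun i t ht =>
    (ncard_quotientLevel_add_le _ i t).trans (Nat.mul_le_mul_right _
      ((Nat.pow_le_pow_left hK t).trans (Nat.pow_le_pow_right hK' ht)))
  rcases le_or_gt j s with hjs | hjs
  · have h0 : (quotientLevel L.reverse 0).ncard ≤ 1 := by
      have : quotientLevel L.reverse 0 = {L.reverse} := by
        simp [quotientLevel]
      rw [this, Set.ncard_singleton]
    have := hstep 0 j hjs
    rw [zero_add] at this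
    calc _ ≤ _ := this
      _ ≤ K ^ s * 1 := Nat.mul_le_mul_left _ h0
      _ ≤ 2 ^ s * K ^ s := by rw [mul_one]; exact Nat.le_mul_of_pos_left _ (by positivity)
  -- A small level `ℓ - j + t` of `L` bounds level `j - t` of the reversal; `t` more letters lead to
  -- level `j`.
  · obtain ⟨t, ht, hq⟩ : ∃ t < s, (quotientLevel L (ℓ - j + t) \ {0}).ncard < s := by
      by_contra! hcon
      have hsum := h.sum_ncard_quotientLevel_le
        ((Finset.range s).map (addLeftEmbedding (ℓ - j)))
      rw [Finset.sum_map] at hsum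
      have : s * s ≤ ∑ t ∈ Finset.range s, (quotientLevel L (ℓ - j + t) \ {0}).ncard := by
        calc s * s = ∑ _t ∈ Finset.range s, s := by simp
          _ ≤ _ := Finset.sum_le_sum fun t ht => hcon t (Finset.mem_range.mp ht)
      simp only [addLeftEmbedding_apply] at hsum
      omega
    have h1 := hstep (j - t) t ht.le
    rw [Nat.sub_add_cancel (by omega)] at h1
    have h2 := h.ncard_quotientLevel_reverse_le (i := ℓ - j + t) (j := j - t) (by omega)
    calc _ ≤ _ := h1
      _ ≤ K ^ s * 2 ^ s := Nat.mul_le_mul_left _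
          (h2.trans (Nat.pow_le_pow_right (by norm_num) hq.le))
      _ = _ := mul_comm _ _

theorem IsBlock.dsc_le_sum_quotientLevel [Finite α] (h : IsBlock ℓ L) :
    dsc L ≤ ∑ i ∈ Finset.range (ℓ + 1), (quotientLevel L i).ncard + 1 := by
  classical
  have hsub : Set.range L.leftQuotient ⊆
      insert 0 (⋃ i ∈ Finset.range (ℓ + 1), quotientLevel L i) := by
    refine h.range_leftQuotient_subset.trans (Set.insert_subset_insert ?_)
    rintro _ ⟨x, hx, rfl⟩
    simp only [Set.mem_iUnion]
    exact ⟨x.length, Finset.mem_range.mpr (Nat.lt_succ_of_le hx), x, rfl, rfl⟩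
  have hfin : (⋃ i ∈ Finset.range (ℓ + 1), quotientLevel L i).Finite :=
    (Finset.finite_toSet _).biUnion fun i _ => quotientLevel_finite L i
  rw [dsc_eq_ncard]
  refine (Set.ncard_le_ncard hsub (hfin.insert 0)).trans
    ((Set.ncard_insert_le _ _).trans (Nat.add_le_add_right ?_ 1))
  exact Finset.set_ncard_biUnion_le _ _

theorem IsBlock.dsc_reverse_le_pow [Fintype α] (h : IsBlock ℓ L) :
    dsc L.reverse ≤ 2 ^ ((Fintype.card α + 4) * (Nat.sqrt (dsc L) + 1)) := by
  set s := Nat.sqrt (dsc L) + 1 with hsdef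
  set k := Fintype.card α
  have hs : dsc L < s * s := Nat.lt_succ_sqrt _
  -- The empty language is separate: there `ℓ` is not bounded by `dsc L`.
  rcases Set.eq_empty_or_nonempty (L : Set (List α)) with hL | ⟨w, hw⟩
  · have hle := h.reverse.dsc_le_of_factors (fun _ => ()) Finset.univ (fun _ _ => Finset.mem_univ _)
      fun x y _ _ _ => by
        ext z
        change (x ++ z).reverse ∈ L ↔ (y ++ z).reverse ∈ L
        rw [hL]
        exact Iff.rfl
    calc _ ≤ 2 ^ 1 := hle
      _ ≤ 2 ^ ((k + 4) * s) := Nat.pow_le_pow_right (by norm_num) (by rw [hsdef]; nlinarith)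
  -- Using `2 ^ k` in place of `k` keeps the base a positive power of two, even for an empty
  -- alphabet.
  · have hk : k ≤ 2 ^ k := Nat.lt_two_pow_self.le
    have hlev : ∀ j ∈ Finset.range (ℓ + 1),
        (quotientLevel L.reverse j).ncard ≤ (2 * 2 ^ k) ^ s := fun j hj =>
      h.ncard_quotientLevel_reverse_le_pow hs hk (by positivity)
        (Nat.lt_succ_iff.mp (Finset.mem_range.mp hj))
    have hsum := h.reverse.dsc_le_sum_quotientLevel.trans
      (Nat.add_le_add_right (Finset.sum_le_sum hlev) 1)
    rw [Finset.sum_const, Finset.card_range, smul_eq_mul] at hsum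
    have hℓ := h.succ_le_dsc hw
    have hs2 : s * s ≤ 4 ^ s := by
      have : s ≤ 2 ^ s := Nat.lt_two_pow_self.le
      calc s * s ≤ 2 ^ s * 2 ^ s := Nat.mul_le_mul this this
        _ = 4 ^ s := by rw [← mul_pow]; norm_num
    set A := (2 * 2 ^ k) ^ s
    have hA : 1 ≤ A := Nat.one_le_pow _ _ (by positivity)
    calc dsc L.reverse ≤ (ℓ + 1) * A + 1 := hsum
      _ ≤ (ℓ + 2) * A := by nlinarith
      _ ≤ 4 ^ s * A := Nat.mul_le_mul_right _ (by omega)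
      -- Now `8 * (2 * 2 ^ k) = 2 ^ (k + 4)`.
      _ ≤ 8 ^ s * A := Nat.mul_le_mul_right _ (Nat.pow_le_pow_left (by norm_num) s)
      _ = 2 ^ ((k + 4) * s) := by
        rw [← mul_pow, pow_mul]; congr 1; ring

theorem IsBlock.dsc_reverse_le_rpow [Fintype α] (h : IsBlock ℓ L) :
    (dsc L.reverse : ℝ) ≤
      (2 : ℝ) ^ (2 * ((Fintype.card α : ℝ) + 4) * √(dsc L : ℝ)) := by
  have hpos : (1 : ℝ) ≤ dsc L := by exact_mod_cast h.dsc_pos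
  have hsqrt : (1 : ℝ) ≤ √(dsc L : ℝ) := Real.one_le_sqrt.mpr hpos
  have hnat : (Nat.sqrt (dsc L) : ℝ) ≤ √(dsc L : ℝ) := Real.nat_sqrt_le_real_sqrt
  calc (dsc L.reverse : ℝ)
      ≤ (2 : ℝ) ^ ((Fintype.card α + 4) * (Nat.sqrt (dsc L) + 1)) := by
        exact_mod_cast h.dsc_reverse_le_pow
    _ = (2 : ℝ) ^ (((Fintype.card α : ℝ) + 4) * ((Nat.sqrt (dsc L) : ℝ) + 1)) := by
        rw [← Real.rpow_natCast]; push_cast; rfl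
    _ ≤ _ := by
        refine Real.rpow_le_rpow_of_exponent_le (by norm_num) ?_
        have : (0 : ℝ) ≤ (Fintype.card α : ℝ) + 4 := by positivity
        nlinarith

end UpperBound

/-! ### Padding by a fixed first letter -/

section Padding

variable {α : Type*} {L : Language α} {ℓ : ℕ}

/-- The language of all words `a w` with `w ∈ L`. -/
def prefixLang (a : α) (L : Language α) : Language α :=
  {w | ∃ v ∈ L, w = a :: v}

theorem cons_mem_prefixLang {a b : α} {w : List α} :
    b :: w ∈ prefixLang a L ↔ b = a ∧ w ∈ L := by
  refine ⟨?_, ?_⟩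
  · rintro ⟨v, hv, h⟩
    obtain ⟨rfl, rfl⟩ := List.cons.inj h
    exact ⟨rfl, hv⟩
  · rintro ⟨rfl, hw⟩
    exact ⟨w, hw, rfl⟩

theorem IsBlock.isBlock_prefixLang (h : IsBlock ℓ L) (a : α) : IsBlock (ℓ + 1) (prefixLang a L) := by
  rintro _ ⟨v, hv, rfl⟩
  simp [h v hv]

/-- The only new quotient is the padded language itself: its words are too long for a quotient of
`L`. A wrong first letter leads to the sink already present. -/
theorem IsBlock.dsc_prefixLang [Finite α] (h : IsBlock ℓ L) (a : α)
    (hne : ∃ w, w ∈ L) : dsc (prefixLang a L) = dsc L + 1 := by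
  have : Nonempty α := ⟨a⟩
  obtain ⟨w, hw⟩ := hne
  have hcons : ∀ x, (prefixLang a L).leftQuotient (a :: x) = L.leftQuotient x := by
    intro x
    ext y
    rw [Language.mem_leftQuotient, List.cons_append, cons_mem_prefixLang]
    simp
  have hrange : Set.range (prefixLang a L).leftQuotient =
      insert (prefixLang a L) (Set.range L.leftQuotient) := by
    apply Set.Subset.antisymm
    · rintro _ ⟨x, rfl⟩
      rcases x with _ | ⟨b, x⟩
      · exact Or.inl rfl
      · by_cases hb : b = a
        · subst hb
          exact Or.inr ⟨x, (hcons x).symm⟩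
        · have h0 : (prefixLang a L).leftQuotient (b :: x) = 0 :=
            Set.eq_empty_of_forall_notMem fun y hy => hb (cons_mem_prefixLang.mp hy).1
          rw [h0]
          exact Or.inr h.zero_mem_range_leftQuotient
    · refine Set.insert_subset ⟨[], rfl⟩ ?_
      rintro _ ⟨x, rfl⟩
      exact ⟨a :: x, hcons x⟩
  rw [dsc_eq_ncard, dsc_eq_ncard, hrange,
    Set.ncard_insert_of_notMem _ h.finite_range_leftQuotient]
  rintro ⟨x, hx⟩
  have hmem : a :: w ∈ L.leftQuotient x := by
    rw [hx]
    exact cons_mem_prefixLang.mpr ⟨rfl, hw⟩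
  have h1 := h.length_of_mem_leftQuotient hmem
  have h2 := h w hw
  simp at h1
  omega

/-- Stripping the final `a` maps the quotients of the padded reversal onto those of `L.reverse`. -/
theorem IsBlock.dsc_reverse_le_dsc_reverse_prefixLang [Finite α] (h : IsBlock ℓ L) (a : α) :
    dsc L.reverse ≤ dsc (prefixLang a L).reverse := by
  have hfin := (h.isBlock_prefixLang a).reverse.finite_range_leftQuotient
  rw [dsc_eq_ncard, dsc_eq_ncard]
  refine le_trans (Set.ncard_le_ncard ?_ (hfin.image fun Q => {w | w ++ [a] ∈ Q}))
    (Set.ncard_image_le hfin)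
  rintro _ ⟨x, rfl⟩
  refine ⟨_, ⟨x, rfl⟩, ?_⟩
  ext w
  change (x ++ (w ++ [a])).reverse ∈ prefixLang a L ↔ (x ++ w).reverse ∈ L
  simp [cons_mem_prefixLang]

theorem IsBlock.exists_padding [Finite α] (a : α) (h : IsBlock ℓ L) (hne : ∃ w, w ∈ L) (t : ℕ) :
    ∃ L' : Language α, IsBlock (ℓ + t) L' ∧ (∃ w, w ∈ L') ∧ dsc L' = dsc L + t ∧
      dsc L.reverse ≤ dsc L'.reverse := by
  induction t with
  | zero => exact ⟨L, h, hne, rfl, le_rfl⟩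
  | succ t ih =>
    obtain ⟨L', h', ⟨w, hw⟩, hd, hr⟩ := ih
    exact ⟨prefixLang a L', h'.isBlock_prefixLang a, ⟨a :: w, cons_mem_prefixLang.mpr ⟨rfl, hw⟩⟩,
      by rw [h'.dsc_prefixLang a ⟨w, hw⟩, hd, add_assoc],
      hr.trans (h'.dsc_reverse_le_dsc_reverse_prefixLang a)⟩

end Padding

/-! ### The bit languages and `MAX_ℓ` -/

section Witness

theorem lexIndex_lt (w : List (Fin 2)) : lexIndex w < 2 ^ w.length := by
  induction w with
  | nil => simp [lexIndex]
  | cons σ w ih =>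
    have : σ.val ≤ 1 := by omega
    rw [lexIndex, List.length_cons, pow_succ]
    nlinarith

theorem lexIndex_append (u v : List (Fin 2)) :
    lexIndex (u ++ v) = lexIndex u * 2 ^ v.length + lexIndex v := by
  induction u with
  | nil => simp [lexIndex]
  | cons σ u ih =>
    rw [List.cons_append, lexIndex, ih, lexIndex, List.length_append, pow_add]
    ring

theorem lexIndex_injOn {u v : List (Fin 2)} (hl : u.length = v.length)
    (h : lexIndex u = lexIndex v) : u = v := by
  induction u generalizing v with
  | nil => exact (List.length_eq_zero_iff.mp hl.symm).symm
  | cons σ u ih =>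
    rcases v with _ | ⟨τ, v⟩
    · simp at hl
    · have hl' : u.length = v.length := by simpa using hl
      rw [lexIndex, lexIndex, hl'] at h
      have hu := lexIndex_lt u
      have hv := lexIndex_lt v
      rw [hl'] at hu
      have hστ : σ = τ := by
        obtain rfl | rfl : σ = 0 ∨ σ = 1 := by omega
        all_goals obtain rfl | rfl : τ = 0 ∨ τ = 1 := by omega
        all_goals simp at h ⊢
        all_goals omega
      subst hστ
      rw [ih hl' (by omega)]

theorem exists_lexIndex_eq {p n : ℕ} (h : n < 2 ^ p) :
    ∃ w : List (Fin 2), w.length = p ∧ lexIndex w = n := by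
  induction p generalizing n with
  | zero => exact ⟨[], rfl, by simp at h; simp [lexIndex, h]⟩
  | succ p ih =>
    rw [pow_succ] at h
    rcases lt_or_ge n (2 ^ p) with hn | hn
    · obtain ⟨w, hw, rfl⟩ := ih hn
      exact ⟨0 :: w, by simp [hw], by simp [lexIndex]⟩
    · obtain ⟨w, hw, hi⟩ := ih (n := n - 2 ^ p) (by omega)
      exact ⟨1 :: w, by simp [hw], by simp [lexIndex, hw, hi]; omega⟩

/-- The words `w₁ w₂` with `|w₁| = p` and `|w₂| = s` such that the bit of weight
`2 ^ lexIndex w₂` of `lexIndex w₁ + 1` is `1`. -/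
def bitLang (p s : ℕ) : Language (Fin 2) :=
  {w | ∃ w₁ w₂ : List (Fin 2), w = w₁ ++ w₂ ∧ w₁.length = p ∧
    w₂.length = s ∧ (lexIndex w₁ + 1).testBit (lexIndex w₂) = true}

theorem append_mem_bitLang {p s : ℕ} {w₁ w₂ : List (Fin 2)} (h : w₂.length = s) :
    w₁ ++ w₂ ∈ bitLang p s ↔
      w₁.length = p ∧ (lexIndex w₁ + 1).testBit (lexIndex w₂) = true := by
  refine ⟨?_, fun hw => ⟨w₁, w₂, rfl, hw.1, h, hw.2⟩⟩
  rintro ⟨u₁, u₂, heq, h1, h2, hb⟩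
  obtain ⟨rfl, rfl⟩ := List.append_inj' heq (h.trans h2.symm)
  exact ⟨h1, hb⟩

theorem isBlock_bitLang (p s : ℕ) : IsBlock (p + s) (bitLang p s) := by
  rintro _ ⟨w₁, w₂, rfl, rfl, rfl, -⟩
  simp

theorem bitLang_nonempty (p s : ℕ) : ∃ w, w ∈ bitLang p s := by
  obtain ⟨w₁, h1, i1⟩ := exists_lexIndex_eq (p := p) (n := 0) (by positivity)
  obtain ⟨w₂, h2, i2⟩ := exists_lexIndex_eq (p := s) (n := 0) (by positivity)
  exact ⟨w₁ ++ w₂, w₁, w₂, rfl, h1, h2, by simp [i1, i2]⟩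

/-- Suffixes of length `s` query the bits below `2 ^ s`, which determine `i + 1 < 2 ^ 2 ^ s`. Since
`i + 1 ≠ 0`, some bit is set and the quotient is nonempty. -/
theorem lt_dsc_bitLang {p s N : ℕ} (h1 : N ≤ 2 ^ p) (h2 : N ≤ 2 ^ 2 ^ s - 1) :
    N < dsc (bitLang p s) := by
  choose! g hg using fun n (hn : n < 2 ^ p) => exists_lexIndex_eq hn
  have hmem : ∀ i < N, ∀ b < 2 ^ s, ∃ w, ∀ j < N,
      (w ∈ (bitLang p s).leftQuotient (g j) ↔ (j + 1).testBit b = true) := by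
    intro i _ b hb
    obtain ⟨w, hw, rfl⟩ := exists_lexIndex_eq hb
    refine ⟨w, fun j hj => ?_⟩
    have := hg j (by omega)
    rw [Language.mem_leftQuotient, append_mem_bitLang hw, this.2]
    simp [this.1]
  have hhigh : ∀ i < N, ∀ b, 2 ^ s ≤ b → (i + 1).testBit b = false := fun i hi b hb =>
    Nat.testBit_lt_two_pow (lt_of_lt_of_le (by omega : i + 1 < 2 ^ 2 ^ s)
      (Nat.pow_le_pow_right (by norm_num) hb))
  refine (isBlock_bitLang p s).lt_dsc_of_injOn g (fun i hi j hj hij => ?_) fun i hi h0 => ?_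
  · refine Nat.succ_injective (Nat.eq_of_testBit_eq fun b => ?_)
    rcases lt_or_ge b (2 ^ s) with hb | hb
    · obtain ⟨w, hw⟩ := hmem i hi b hb
      have := hw i hi
      rw [hij, hw j hj] at this
      exact (Bool.eq_iff_iff.mpr this).symm
    · rw [Nat.succ_eq_add_one, Nat.succ_eq_add_one, hhigh i hi b hb, hhigh j hj b hb]
  · obtain ⟨b, hb⟩ := Nat.exists_testBit_of_ne_zero (x := i + 1) (by omega)
    rcases lt_or_ge b (2 ^ s) with hbs | hbs
    · obtain ⟨w, hw⟩ := hmem i hi b hbs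
      have := (hw i hi).mpr hb
      rw [h0] at this
      exact this
    · simp [hhigh i hi b hbs] at hb

/-- If adding `1` carries out of the low `P` bits, then `a = a'`; otherwise the high bits come from
`x` and the low ones from `a + 1`. -/
theorem testBit_succ_congr {P a a' j : ℕ} (ha : a < 2 ^ P) (ha' : a' < 2 ^ P)
    (hc : a + 1 = 2 ^ P ↔ a' + 1 = 2 ^ P) (hb : (a + 1).testBit j = (a' + 1).testBit j) (x : ℕ) :
    (x * 2 ^ P + a + 1).testBit j = (x * 2 ^ P + a' + 1).testBit j := by
  by_cases h : a + 1 = 2 ^ P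
  · have : a = a' := by have := hc.mp h; omega
    rw [this]
  · have h' : a' + 1 ≠ 2 ^ P := fun h' => h (hc.mpr h')
    rw [mul_comm, add_assoc, add_assoc, Nat.testBit_two_pow_mul_add _ (by omega),
      Nat.testBit_two_pow_mul_add _ (by omega), hb]

theorem dsc_reverse_bitLang_le (p s : ℕ) :
    dsc (bitLang p s).reverse ≤ 4 * (p + s + 1) * 2 ^ s + 1 := by
  -- The state: letters read, bit index, whether the increment still carries, and the current value
  -- of the queried bit.
  let f : List (Fin 2) → ((ℕ × ℕ) × Bool × Bool) := fun u =>
    ((u.length, lexIndex (u.take s).reverse),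
      (decide (lexIndex (u.drop s).reverse + 1 = 2 ^ (u.drop s).length),
        (lexIndex (u.drop s).reverse + 1).testBit (lexIndex (u.take s).reverse)))
  have hcard := (isBlock_bitLang p s).reverse.dsc_le_of_factors f
    ((Finset.range (p + s + 1) ×ˢ Finset.range (2 ^ s)) ×ˢ Finset.univ) ?_ ?_
  · refine hcard.trans_eq ?_
    simp
    ring
  · intro u hu
    have h1 := lexIndex_lt (u.take s).reverse
    have h2 : 2 ^ (u.take s).reverse.length ≤ 2 ^ s :=
      Nat.pow_le_pow_right (by norm_num) (by simp)
    simp [f]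
    exact ⟨by omega, by omega⟩
  · intro u u' hu hu' hf
    simp only [f, Prod.mk.injEq, decide_eq_decide] at hf
    obtain ⟨⟨hlen, hidx⟩, hc, hb⟩ := hf
    have htake : u.take s = u'.take s :=
      List.reverse_injective (lexIndex_injOn (by simp [hlen]) hidx)
    rcases le_or_gt u.length s with hs | hs
    · rw [List.take_of_length_le hs, List.take_of_length_le (hlen ▸ hs)] at htake
      rw [htake]
    · have hdrop : (u.drop s).length = (u'.drop s).length := by simp [hlen]
      have key : ∀ u : List (Fin 2), s < u.length → ∀ v,
          (v ∈ (bitLang p s).reverse.leftQuotient u ↔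
            v.length + (u.drop s).length = p ∧
            (lexIndex v.reverse * 2 ^ (u.drop s).length + lexIndex (u.drop s).reverse + 1).testBit
              (lexIndex (u.take s).reverse) = true) := by
        intro u hs v
        rw [Language.mem_leftQuotient, Language.mem_reverse]
        conv_lhs => rw [← List.take_append_drop s u]
        rw [List.append_assoc, List.reverse_append, append_mem_bitLang (by simp; omega),
          List.reverse_append, lexIndex_append]
        simp [-List.length_drop]
      ext v
      have h1 := lexIndex_lt (u.drop s).reverse
      have h2 := lexIndex_lt (u'.drop s).reverse
      rw [List.length_reverse] at h1 h2
      rw [← htake] at hb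
      rw [← hdrop] at hc h2
      rw [key u hs, key u' (hlen ▸ hs), ← htake, ← hdrop, testBit_succ_congr h1 h2 hc hb]

/-! ### Choice of the split point and bounds for `MAX_ℓ` -/

theorem rankMin_spec {ℓ : ℕ} :
    rankMin ℓ ≤ ℓ ∧ 2 ^ (ℓ - rankMin ℓ) ≤ 2 ^ 2 ^ rankMin ℓ - 1 := by
  refine Nat.sInf_mem (s := {i : ℕ | i ≤ ℓ ∧ 2 ^ (ℓ - i) ≤ 2 ^ (2 ^ i) - 1}) ⟨ℓ, le_rfl, ?_⟩
  have : 2 ^ 1 ≤ 2 ^ 2 ^ ℓ := Nat.pow_le_pow_right (by norm_num) Nat.one_le_two_pow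
  simp
  omega

theorem rankMin_le {ℓ i : ℕ} (hi : i ≤ ℓ) (h : ℓ - i < 2 ^ i) : rankMin ℓ ≤ i := by
  refine Nat.sInf_le ⟨hi, ?_⟩
  have : 2 ^ (ℓ - i) < 2 ^ 2 ^ i := Nat.pow_lt_pow_right (by norm_num) h
  omega

theorem lt_two_pow_of_lt_rankMin {ℓ i : ℕ} (h : i < rankMin ℓ) :
    2 ^ 2 ^ i - 1 < 2 ^ (ℓ - i) := by
  have := Nat.notMem_of_lt_sInf h
  have hle := rankMin_spec (ℓ := ℓ)
  by_contra hcon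
  exact this ⟨by omega, by omega⟩

theorem rankMin_pos {ℓ : ℕ} : 0 < ℓ → 0 < rankMin ℓ := by
  intro hℓ
  by_contra h0
  have h := (rankMin_spec (ℓ := ℓ)).2
  have h0 : rankMin ℓ = 0 := by omega
  rw [h0] at h
  have : 2 ^ 1 ≤ 2 ^ ℓ := Nat.pow_le_pow_right (by norm_num) hℓ
  simp at h
  omega

theorem splitRank_le_rankMin (ℓ : ℕ) : splitRank ℓ ≤ rankMin ℓ := by
  unfold splitRank
  split_ifs <;> omega

/-- Minimality makes `rankMin ℓ - 1` fail its defining inequality, which bounds `2 ^ (rankMin ℓ -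
1)` by `ℓ`. -/
theorem two_pow_splitRank_le {ℓ : ℕ} (hℓ : 0 < ℓ) : 2 ^ splitRank ℓ ≤ 2 * ℓ := by
  have hr := rankMin_pos hℓ
  have h1 := lt_two_pow_of_lt_rankMin (ℓ := ℓ) (i := rankMin ℓ - 1) (by omega)
  have h2 : 2 ^ (rankMin ℓ - 1) ≤ ℓ - (rankMin ℓ - 1) :=
    (Nat.pow_le_pow_iff_right (le_refl 2)).mp (by omega)
  have h3 : 2 ^ splitRank ℓ ≤ 2 ^ (rankMin ℓ - 1 + 1) :=
    Nat.pow_le_pow_right (by norm_num) (by have := splitRank_le_rankMin ℓ; omega)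
  rw [pow_succ] at h3
  omega

theorem rankMin_le_half (ℓ : ℕ) : rankMin ℓ ≤ ℓ - ℓ / 2 := by
  refine rankMin_le (by omega) ?_
  have : ℓ - ℓ / 2 < 2 ^ (ℓ - ℓ / 2) := Nat.lt_two_pow_self
  omega

theorem maxLang_eq_bitLang (ℓ : ℕ) : maxLang ℓ = bitLang (ℓ - splitRank ℓ) (splitRank ℓ) := rfl

theorem splitRank_le (ℓ : ℕ) : splitRank ℓ ≤ ℓ :=
  (splitRank_le_rankMin ℓ).trans rankMin_spec.1

theorem isBlock_maxLang (ℓ : ℕ) : IsBlock ℓ (maxLang ℓ) := by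
  have := isBlock_bitLang (ℓ - splitRank ℓ) (splitRank ℓ)
  rwa [Nat.sub_add_cancel (splitRank_le ℓ)] at this

theorem dsc_reverse_maxLang_le {ℓ : ℕ} (hℓ : 0 < ℓ) : dsc (maxLang ℓ).reverse ≤ 17 * ℓ ^ 2 := by
  have h1 := dsc_reverse_bitLang_le (ℓ - splitRank ℓ) (splitRank ℓ)
  rw [Nat.sub_add_cancel (splitRank_le ℓ), ← maxLang_eq_bitLang] at h1
  have h2 := Nat.mul_le_mul_left (4 * (ℓ + 1)) (two_pow_splitRank_le hℓ)
  nlinarith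

theorem two_pow_half_lt_dsc_maxLang {ℓ : ℕ} (hℓ : 0 < ℓ) : 2 ^ (ℓ / 2) < dsc (maxLang ℓ) := by
  have hr := rankMin_pos hℓ
  have hhalf : 2 ^ (ℓ / 2) ≤ 2 ^ (ℓ - rankMin ℓ) :=
    Nat.pow_le_pow_right (by norm_num) (by have := rankMin_le_half ℓ; omega)
  rw [maxLang_eq_bitLang]
  -- For either split, both bounds required by `lt_dsc_bitLang` are at least `2 ^ (ℓ - rankMin ℓ)`.
  by_cases h : max (2 ^ (ℓ - rankMin ℓ)) (2 ^ (2 ^ (rankMin ℓ - 1)) - 1) = 2 ^ (ℓ - rankMin ℓ)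
  · have hs : splitRank ℓ = rankMin ℓ := if_pos h
    rw [hs]
    exact lt_dsc_bitLang hhalf (hhalf.trans rankMin_spec.2)
  · have hs : splitRank ℓ = rankMin ℓ - 1 := if_neg h
    rw [hs]
    rw [max_eq_left_iff, not_le] at h
    exact lt_dsc_bitLang (hhalf.trans (Nat.pow_le_pow_right (by norm_num) (by omega)))
      (hhalf.trans h.le)

theorem rpow_le_dsc_maxLang {ℓ : ℕ} (hℓ : 0 < ℓ) :
    (2 : ℝ) ^ ((ℓ : ℝ) / 3) ≤ dsc (maxLang ℓ) := by
  have h := two_pow_half_lt_dsc_maxLang hℓ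
  -- Rounding down gives `ℓ / 2 ≥ ℓ / 3` except at `ℓ = 1`, where the strict inequality yields two
  -- states.
  rcases eq_or_ne ℓ 1 with rfl | h1
  · have h2 : (2 : ℝ) ≤ dsc (maxLang 1) := by exact_mod_cast h
    refine le_trans ?_ h2
    calc (2 : ℝ) ^ (((1 : ℕ) : ℝ) / 3) ≤ 2 ^ (1 : ℝ) :=
          Real.rpow_le_rpow_of_exponent_le (by norm_num) (by norm_num)
      _ = 2 := Real.rpow_one 2
  · have h2 : (2 : ℝ) ^ (ℓ / 2) ≤ dsc (maxLang ℓ) := by exact_mod_cast h.le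
    refine le_trans ?_ h2
    rw [← Real.rpow_natCast]
    refine Real.rpow_le_rpow_of_exponent_le (by norm_num) ?_
    have : ℓ ≤ 3 * (ℓ / 2) := by omega
    have : (ℓ : ℝ) ≤ 3 * ((ℓ / 2 : ℕ) : ℝ) := by exact_mod_cast this
    linarith

theorem sqrt_dsc_reverse_maxLang_le {ℓ : ℕ} (hℓ : 0 < ℓ) :
    √(dsc (maxLang ℓ).reverse : ℝ) ≤ 5 * ℓ := by
  have h : (dsc (maxLang ℓ).reverse : ℝ) ≤ 17 * (ℓ : ℝ) ^ 2 := by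
    exact_mod_cast dsc_reverse_maxLang_le hℓ
  refine Real.sqrt_le_iff.mpr ⟨by positivity, ?_⟩
  nlinarith [sq_nonneg (ℓ : ℝ)]

end Witness

/-! ### Tightness for every number of states -/

section Tightness

theorem isBlock_one (α : Type*) : IsBlock 0 (1 : Language α) := by
  intro w hw
  rw [Language.mem_one] at hw
  simp [hw]

theorem dsc_one (α : Type*) [Finite α] [Nonempty α] : dsc (1 : Language α) = 2 := by
  refine le_antisymm ?_ ?_
  · refine (isBlock_one α).dsc_le_of_factors (fun _ => ()) Finset.univ
      (fun _ _ => Finset.mem_univ _) fun x y hx hy _ => ?_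
    rw [List.length_eq_zero_iff.mp (Nat.le_zero.mp hx),
      List.length_eq_zero_iff.mp (Nat.le_zero.mp hy)]
  · refine (isBlock_one α).lt_dsc_of_injOn (N := 1) (fun _ => []) (by omega) fun _ _ h => ?_
    have : [] ∈ (1 : Language α) := Language.nil_mem_one
    rw [Language.leftQuotient_nil] at h
    rw [h] at this
    exact this

/-- A block language with few states can be padded to one with exactly `m` states. -/
theorem IsBlock.exists_dsc_eq {L : Language (Fin 2)} {ℓ m : ℕ} (h : IsBlock ℓ L)
    (hne : ∃ w, w ∈ L) (hm : dsc L ≤ m) : ∃ L' : Language (Fin 2),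
      IsBlock (ℓ + (m - dsc L)) L' ∧ dsc L' = m ∧ dsc L.reverse ≤ dsc L'.reverse := by
  obtain ⟨L', h1, -, h2, h3⟩ := h.exists_padding 0 hne (m - dsc L)
  exact ⟨L', h1, by omega, h3⟩

theorem exists_block_rpow_le_dsc_reverse {m : ℕ} (hm : 3 ≤ m) :
    ∃ ℓ : ℕ, 0 < ℓ ∧ ∃ L : Language (Fin 2), IsBlock ℓ L ∧ dsc L = m ∧
      (2 : ℝ) ^ ((1 / 27 : ℝ) * √(m : ℝ)) ≤ (dsc L.reverse : ℝ) := by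
  -- Below `17` the bound `17 * ℓ ^ 2` admits no `ℓ > 0`; padding the two-state language `1`
  -- suffices, and `m ≥ 3` makes the block length positive.
  rcases lt_or_ge m 17 with hlt | hge
  · have hone := dsc_one (Fin 2)
    obtain ⟨L, h1, h2, h3⟩ := (isBlock_one (Fin 2)).exists_dsc_eq
      ⟨[], Language.nil_mem_one⟩ (m := m) (by omega)
    refine ⟨_, by omega, L, h1, h2, ?_⟩
    rw [Language.reverse_one, hone] at h3
    have h3 : (2 : ℝ) ≤ dsc L.reverse := by exact_mod_cast h3
    refine le_trans ?_ h3
    have hs : √(m : ℝ) ≤ 27 := by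
      have : (m : ℝ) ≤ 17 := by exact_mod_cast hlt.le
      exact Real.sqrt_le_iff.mpr ⟨by norm_num, by linarith⟩
    calc (2 : ℝ) ^ ((1 / 27 : ℝ) * √(m : ℝ)) ≤ 2 ^ (1 : ℝ) :=
          Real.rpow_le_rpow_of_exponent_le (by norm_num) (by linarith)
      _ = 2 := Real.rpow_one 2
  · set ℓ := Nat.sqrt (m / 17)
    have hℓ : 0 < ℓ := Nat.sqrt_pos.mpr (by omega)
    have hle : ℓ * ℓ ≤ m / 17 := Nat.sqrt_le _
    have hlt : m / 17 < (ℓ + 1) * (ℓ + 1) := Nat.lt_succ_sqrt _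
    have hd : dsc (maxLang ℓ).reverse ≤ m := by
      have := dsc_reverse_maxLang_le hℓ
      rw [pow_two] at this
      omega
    have hne : ∃ w, w ∈ (maxLang ℓ).reverse := by
      obtain ⟨w, hw⟩ := bitLang_nonempty (ℓ - splitRank ℓ) (splitRank ℓ)
      exact ⟨w.reverse, Language.reverse_mem_reverse.mpr hw⟩
    obtain ⟨L, h1, h2, h3⟩ := (isBlock_maxLang ℓ).reverse.exists_dsc_eq hne hd
    refine ⟨_, by omega, L, h1, h2, ?_⟩
    rw [Language.reverse_reverse] at h3
    refine le_trans (le_trans ?_ (rpow_le_dsc_maxLang hℓ)) (Nat.cast_le.mpr h3)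
    refine Real.rpow_le_rpow_of_exponent_le (by norm_num) ?_
    -- Maximality of `ℓ` gives `m < 68 * ℓ ^ 2`, rounded up to the square `81`; then `1 / 27 = (1 /
    -- 3) / 9`.
    have hs : √(m : ℝ) ≤ 9 * ℓ := by
      have hnat : m ≤ 81 * (ℓ * ℓ) := by
        have : (ℓ + 1) * (ℓ + 1) ≤ 4 * (ℓ * ℓ) := by nlinarith
        omega
      have : (m : ℝ) ≤ 81 * ((ℓ : ℝ) * ℓ) := by exact_mod_cast hnat
      exact Real.sqrt_le_iff.mpr ⟨by positivity, by nlinarith⟩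
    linarith

end Tightness

end BlockLanguage

/-! ### Assembly of the three statements -/

theorem mainTheorem6 :
    -- upper bound: the constant depends only on the size of the alphabet
    (∀ k : ℕ, ∃ C : ℝ, 0 < C ∧
      ∀ (α : Type*) [Fintype α], Fintype.card α = k →
        ∀ ℓ : ℕ, 0 < ℓ → ∀ L : Language α, BlockLanguage.IsBlock ℓ L →
          (BlockLanguage.dsc L.reverse : ℝ) ≤ (2 : ℝ) ^ (C * √(BlockLanguage.dsc L : ℝ))) ∧
    -- tightness of the bound, in terms of the state complexity, over a binary alphabet
    (∃ c : ℝ, 0 < c ∧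
      ∀ m : ℕ, 3 ≤ m → ∃ ℓ : ℕ, 0 < ℓ ∧ ∃ L : Language (Fin 2), BlockLanguage.IsBlock ℓ L ∧
        BlockLanguage.dsc L = m ∧
          (2 : ℝ) ^ (c * √(m : ℝ)) ≤ (BlockLanguage.dsc L.reverse : ℝ)) ∧
    -- the witnesses: the reversals of the languages `MAX_ℓ`
    (∃ C c : ℝ, 0 < C ∧ 0 < c ∧ ∀ ℓ : ℕ, 0 < ℓ →
      BlockLanguage.IsBlock ℓ (BlockLanguage.maxLang ℓ) ∧
      (BlockLanguage.dsc (BlockLanguage.maxLang ℓ).reverse : ℝ) ≤ C * (ℓ : ℝ) ^ 2 ∧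
      (2 : ℝ) ^ (c * (ℓ : ℝ)) ≤ (BlockLanguage.dsc (BlockLanguage.maxLang ℓ) : ℝ) ∧
      (2 : ℝ) ^ (c * √(BlockLanguage.dsc (BlockLanguage.maxLang ℓ).reverse : ℝ)) ≤
        (BlockLanguage.dsc (BlockLanguage.maxLang ℓ) : ℝ)) := by
  refine ⟨fun k => ⟨2 * ((k : ℝ) + 4), by positivity, ?_⟩,
    ⟨1 / 27, by norm_num, fun m hm => BlockLanguage.exists_block_rpow_le_dsc_reverse hm⟩,
    -- `1 / 15 = (1 / 3) / 5`, from the exponent `ℓ / 3` and the bound `5 * ℓ` on the square root.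
    ⟨17, 1 / 15, by norm_num, by norm_num, fun ℓ hℓ => ⟨BlockLanguage.isBlock_maxLang ℓ, ?_,
      le_trans ?_ (BlockLanguage.rpow_le_dsc_maxLang hℓ),
      le_trans ?_ (BlockLanguage.rpow_le_dsc_maxLang hℓ)⟩⟩⟩
  · rintro α _ rfl ℓ - L hL
    exact hL.dsc_reverse_le_rpow
  · exact_mod_cast BlockLanguage.dsc_reverse_maxLang_le hℓ
  · refine Real.rpow_le_rpow_of_exponent_le (by norm_num) ?_
    have : (0 : ℝ) ≤ ℓ := Nat.cast_nonneg ℓ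
    linarith
  · refine Real.rpow_le_rpow_of_exponent_le (by norm_num) ?_
    have := BlockLanguage.sqrt_dsc_reverse_maxLang_le hℓ
    linarith
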